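/- Let $1\le p<\infty$. Let $H^p(\mathbb{D})$ be the space of all holomorphic functions $f$ on the open unit disk $\mathbb{D}$ with $$\|f\|_p=\Bigl(\sup_{0<r<1}\frac1{2\pi}\int_0^{2\pi}|f(re^{i\theta})|^p\,d\theta\Bigr)^{1/p}<\infty ,$$ normed by $\|\cdot\|_p$. A bounded operator $T$ on a complex normed space $X$ has the positive shadowing property if for every $\varepsilon>0$ there is $\delta>0$ such that for every sequence $(x_n)_{n\ge1}$ in $X$ with $\|Tx_n-x_{n+1}\|\le\delta$ for all $n\ge1$ there exists $x\in X$ with $\|T^nx-x_n\|\le\varepsilon$ for all $n\ge1$. Let $\phi(z)=\frac{az+b}{cz+d}$, with $a,b,c,d\in\mathbb{C}$ and $ad-bc\ne0$, be a linear fractional map with $\phi(\mathbb{D})\subset\mathbb{D}$ that is parabolic, i.e. has exactly one fixed point in the Riemann sphere $\mathbb{C}\cup\{\infty\}$. Then the composition operator $C_\phi f=f\circ\phi$ is a bounded operator on $H^p(\mathbb{D})$, and it does not have the positive shadowing property. -/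

import Mathlib

open scoped Complex.UnitDisc

noncomputable section

namespace HardyShadowing

/-- Extension by `0` of a function on the open unit disc to the whole plane. -/
def ext (f : 𝔻 → ℂ) : ℂ → ℂ := Function.extend (fun z : 𝔻 => (z : ℂ)) f 0

/-- `f` is holomorphic on the open unit disc. -/
def IsHol (f : 𝔻 → ℂ) : Prop := DifferentiableOn ℂ (ext f) (Metric.ball 0 1)

/-- The integral mean `(1 / 2π) ∫₀^{2π} |f (r e^{iθ})|^p dθ`. -/
def mean (p : ℝ) (f : 𝔻 → ℂ) (r : ℝ) : ℝ :=
  Real.circleAverage (fun z => ‖ext f z‖ ^ p) 0 r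

/-- `‖f‖_p = (sup_{0 < r < 1} (1 / 2π) ∫₀^{2π} |f (r e^{iθ})|^p dθ)^{1/p}`. -/
def hpNorm (p : ℝ) (f : 𝔻 → ℂ) : ℝ :=
  (⨆ r : Set.Ioo (0 : ℝ) 1, mean p f r) ^ (1 / p)

/-- `f` belongs to the Hardy space: it is holomorphic and its integral means are bounded. -/
def MemHp (p : ℝ) (f : 𝔻 → ℂ) : Prop :=
  IsHol f ∧ BddAbove (Set.range fun r : Set.Ioo (0 : ℝ) 1 => mean p f r)

theorem ext_coe (f : 𝔻 → ℂ) (z : 𝔻) : ext f z = f z :=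
  Complex.UnitDisc.coe_injective.extend_apply f 0 z

theorem ext_zero : ext 0 = 0 := Function.extend_zero _

theorem ext_add (f g : 𝔻 → ℂ) : ext (f + g) = ext f + ext g := by
  simpa [ext] using Function.extend_add (fun z : 𝔻 => (z : ℂ)) f g 0 0

theorem ext_smul (c : ℂ) (f : 𝔻 → ℂ) : ext (c • f) = c • ext f := by
  simpa [ext] using Function.extend_smul c (fun z : 𝔻 => (z : ℂ)) f 0

theorem mean_nonneg (p : ℝ) (f : 𝔻 → ℂ) (r : ℝ) : 0 ≤ mean p f r := by
  unfold mean Real.circleAverage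
  refine smul_nonneg (by positivity) ?_
  exact intervalIntegral.integral_nonneg (by positivity) (fun θ _ => by positivity)

theorem IsHol.continuous_circle {f : 𝔻 → ℂ} (hf : IsHol f) {r : ℝ} (hr : r ∈ Set.Ioo (0 : ℝ) 1) :
    Continuous fun θ : ℝ => ext f (circleMap 0 r θ) := by
  refine hf.continuousOn.comp_continuous (continuous_circleMap 0 r) fun θ => ?_
  simp [abs_of_pos hr.1, hr.2]

/-- Minkowski's inequality on a circle. -/
theorem mean_add_le {p : ℝ} (hp : 1 ≤ p) {f g : 𝔻 → ℂ} (hf : IsHol f) (hg : IsHol g) {r : ℝ}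
    (hr : r ∈ Set.Ioo (0 : ℝ) 1) :
    mean p (f + g) r ^ (1 / p) ≤ mean p f r ^ (1 / p) + mean p g r ^ (1 / p) := by
  have hp0 : 0 < p := by linarith
  set μ := (MeasureTheory.volume : MeasureTheory.Measure ℝ).restrict
    (Set.Ioc 0 (2 * Real.pi)) with hμ
  have key : ∀ u : ℝ → ℂ, Continuous u → MeasureTheory.MemLp u (ENNReal.ofReal p) μ := by
    intro u hu
    obtain ⟨C, hC⟩ := (isCompact_Icc (a := (0 : ℝ)) (b := 2 * Real.pi)).exists_bound_of_continuousOn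
      hu.continuousOn
    refine MeasureTheory.MemLp.of_bound hu.aestronglyMeasurable C ?_
    refine (MeasureTheory.ae_restrict_iff' measurableSet_Ioc).2 (Filter.Eventually.of_forall ?_)
    exact fun x hx => hC x ⟨hx.1.le, hx.2⟩
  have eq1 : ∀ u : ℝ → ℂ, Continuous u → (MeasureTheory.eLpNorm u (ENNReal.ofReal p) μ).toReal
      = (∫ θ in (0 : ℝ)..2 * Real.pi, ‖u θ‖ ^ p) ^ (1 / p) := by
    intro u hu
    rw [(key u hu).eLpNorm_eq_integral_rpow_norm (by simpa using hp0) ENNReal.ofReal_ne_top,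
      ENNReal.toReal_ofReal (by positivity), ENNReal.toReal_ofReal hp0.le,
      intervalIntegral.integral_of_le (by positivity), one_div]
  have hfc := hf.continuous_circle hr
  have hgc := hg.continuous_circle hr
  have mk := MeasureTheory.eLpNorm_add_le (p := ENNReal.ofReal p) (key _ hfc).1 (key _ hgc).1
    (by simpa using hp)
  have mk2 := ENNReal.toReal_mono (ENNReal.add_ne_top.2 ⟨(key _ hfc).2.ne, (key _ hgc).2.ne⟩) mk
  rw [ENNReal.toReal_add (key _ hfc).2.ne (key _ hgc).2.ne, eq1 _ hfc, eq1 _ hgc,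
    eq1 _ (hfc.add hgc)] at mk2
  have split : ∀ h : 𝔻 → ℂ, mean p h r ^ (1 / p) = ((2 * Real.pi)⁻¹) ^ (1 / p) *
      (∫ θ in (0 : ℝ)..2 * Real.pi, ‖ext h (circleMap 0 r θ)‖ ^ p) ^ (1 / p) := by
    intro h
    rw [← Real.mul_rpow (by positivity)
      (intervalIntegral.integral_nonneg (by positivity) (fun θ _ => by positivity))]
    rfl
  rw [split, split, split, ← mul_add, ext_add]
  exact mul_le_mul_of_nonneg_left mk2 (by positivity)

theorem mean_smul {p : ℝ} (c : ℂ) (f : 𝔻 → ℂ) (r : ℝ) :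
    mean p (c • f) r = ‖c‖ ^ p * mean p f r := by
  unfold mean
  rw [ext_smul, ← smul_eq_mul, ← Real.circleAverage_fun_smul]
  congr 1
  ext z
  simp [Real.mul_rpow]

theorem hpNorm_nonneg (p : ℝ) (f : 𝔻 → ℂ) : 0 ≤ hpNorm p f :=
  Real.rpow_nonneg (Real.iSup_nonneg fun _ => mean_nonneg _ _ _) _

theorem MemHp.mean_le {p : ℝ} (hp : 1 ≤ p) {f : 𝔻 → ℂ} (hf : MemHp p f) {r : ℝ}
    (hr : r ∈ Set.Ioo (0 : ℝ) 1) : mean p f r ^ (1 / p) ≤ hpNorm p f :=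
  Real.rpow_le_rpow (mean_nonneg _ _ _) (le_ciSup hf.2 ⟨r, hr⟩) (by positivity)

theorem mean_le_of_rpow_le {p : ℝ} (hp : 1 ≤ p) {f : 𝔻 → ℂ} {r C : ℝ}
    (h : mean p f r ^ (1 / p) ≤ C) : mean p f r ≤ C ^ p := by
  have h1 := Real.rpow_le_rpow (Real.rpow_nonneg (mean_nonneg p f r) _) h (by linarith : 0 ≤ p)
  rwa [← Real.rpow_mul (mean_nonneg _ _ _), one_div_mul_cancel (by linarith), Real.rpow_one] at h1

theorem MemHp.add {p : ℝ} (hp : 1 ≤ p) {f g : 𝔻 → ℂ} (hf : MemHp p f) (hg : MemHp p g) :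
    MemHp p (f + g) := by
  refine ⟨?_, (hpNorm p f + hpNorm p g) ^ p, ?_⟩
  · unfold IsHol
    rw [ext_add]
    exact DifferentiableOn.add hf.1 hg.1
  · rintro _ ⟨r, rfl⟩
    exact mean_le_of_rpow_le hp ((mean_add_le hp hf.1 hg.1 r.2).trans
      (add_le_add (hf.mean_le hp r.2) (hg.mean_le hp r.2)))

theorem MemHp.smul {p : ℝ} (c : ℂ) {f : 𝔻 → ℂ} (hf : MemHp p f) : MemHp p (c • f) := by
  refine ⟨?_, ?_⟩
  · unfold IsHol
    rw [ext_smul]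
    exact DifferentiableOn.const_smul hf.1 c
  · obtain ⟨C, hC⟩ := hf.2
    refine ⟨‖c‖ ^ p * C, ?_⟩
    rintro _ ⟨r, rfl⟩
    simp only [mean_smul]
    exact mul_le_mul_of_nonneg_left (hC ⟨r, rfl⟩) (by positivity)

theorem mean_zero {p : ℝ} (hp : 1 ≤ p) (r : ℝ) : mean p 0 r = 0 := by
  have h := mean_smul (p := p) 0 (0 : 𝔻 → ℂ) r
  simpa [Real.zero_rpow (by linarith : p ≠ 0)] using h

theorem MemHp.zero {p : ℝ} (hp : 1 ≤ p) : MemHp p 0 := by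
  refine ⟨?_, 0, ?_⟩
  · unfold IsHol
    rw [ext_zero]
    exact differentiableOn_const 0
  · rintro _ ⟨r, rfl⟩
    exact (mean_zero hp r).le

theorem hpNorm_add_le {p : ℝ} (hp : 1 ≤ p) {f g : 𝔻 → ℂ} (hf : MemHp p f) (hg : MemHp p g) :
    hpNorm p (f + g) ≤ hpNorm p f + hpNorm p g := by
  have : Nonempty (Set.Ioo (0 : ℝ) 1) := ⟨⟨1 / 2, by norm_num, by norm_num⟩⟩
  have hC : 0 ≤ hpNorm p f + hpNorm p g := add_nonneg (hpNorm_nonneg _ _) (hpNorm_nonneg _ _)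
  have h1 : (⨆ r : Set.Ioo (0 : ℝ) 1, mean p (f + g) r) ≤ (hpNorm p f + hpNorm p g) ^ p :=
    ciSup_le fun r => mean_le_of_rpow_le hp ((mean_add_le hp hf.1 hg.1 r.2).trans
      (add_le_add (hf.mean_le hp r.2) (hg.mean_le hp r.2)))
  have h2 := Real.rpow_le_rpow (Real.iSup_nonneg fun _ => mean_nonneg _ _ _) h1
    (by positivity : 0 ≤ 1 / p)
  rwa [← Real.rpow_mul hC, mul_one_div_cancel (by linarith), Real.rpow_one] at h2

theorem hpNorm_smul {p : ℝ} (hp : 1 ≤ p) (c : ℂ) (f : 𝔻 → ℂ) :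
    hpNorm p (c • f) = ‖c‖ * hpNorm p f := by
  unfold hpNorm
  simp only [mean_smul]
  rw [← Real.mul_iSup_of_nonneg (by positivity), Real.mul_rpow (by positivity)
    (Real.iSup_nonneg fun _ => mean_nonneg _ _ _), ← Real.rpow_mul (norm_nonneg c),
    mul_one_div_cancel (by linarith), Real.rpow_one]

theorem eq_zero_of_hpNorm {p : ℝ} (hp : 1 ≤ p) {f : 𝔻 → ℂ} (hf : MemHp p f)
    (h : hpNorm p f = 0) : f = 0 := by
  have hp0 : 0 < p := by linarith
  have hm : ∀ r ∈ Set.Ioo (0 : ℝ) 1, ∀ θ, ext f (circleMap 0 r θ) = 0 := by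
    intro r hr
    have h0 : mean p f r = 0 := by
      have h1 := mean_le_of_rpow_le hp (h ▸ hf.mean_le hp hr)
      rw [Real.zero_rpow hp0.ne'] at h1
      exact le_antisymm h1 (mean_nonneg _ _ _)
    have hc : Continuous fun θ : ℝ => ‖ext f (circleMap 0 r θ)‖ ^ p :=
      (hf.1.continuous_circle hr).norm.rpow_const fun _ => Or.inr hp0.le
    have h1 : ∫ θ in (0 : ℝ)..2 * Real.pi, ‖ext f (circleMap 0 r θ)‖ ^ p = 0 := by
      have : (2 * Real.pi)⁻¹ * ∫ θ in (0 : ℝ)..2 * Real.pi, ‖ext f (circleMap 0 r θ)‖ ^ p = 0 := h0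
      exact (mul_eq_zero.1 this).resolve_left (by positivity)
    have hI : ∀ θ ∈ Set.Ico (0 : ℝ) (2 * Real.pi), ext f (circleMap 0 r θ) = 0 := by
      intro θ hθ
      by_contra hne
      have hpos := intervalIntegral.integral_pos (a := 0) (b := 2 * Real.pi) (by positivity)
        hc.continuousOn (fun x _ => by positivity)
        ⟨θ, ⟨hθ.1, hθ.2.le⟩, Real.rpow_pos_of_pos (norm_pos_iff.2 hne) p⟩
      exact hpos.ne' h1
    intro θ
    obtain ⟨y, hy, hyeq⟩ := (periodic_circleMap 0 r).exists_mem_Ico₀ Real.two_pi_pos θ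
    rw [hyeq]
    exact hI y hy
  have hz : ∀ w : ℂ, w ∈ Metric.ball (0 : ℂ) 1 → w ≠ 0 → ext f w = 0 := by
    intro w hw hw0
    have := hm ‖w‖ ⟨norm_pos_iff.2 hw0, by simpa using hw⟩ w.arg
    rwa [circleMap_zero, Complex.norm_mul_exp_arg_mul_I] at this
  have h0 : ext f 0 = 0 := by
    have hcont : ContinuousAt (ext f) 0 :=
      hf.1.continuousOn.continuousAt (Metric.ball_mem_nhds 0 one_pos)
    refine tendsto_nhds_unique (hcont.tendsto.mono_left (nhdsWithin_le_nhds (s := {0}ᶜ))) ?_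
    refine tendsto_const_nhds.congr' ?_
    filter_upwards [nhdsWithin_le_nhds (Metric.ball_mem_nhds (0 : ℂ) one_pos),
      self_mem_nhdsWithin] with w hw hw0
    exact (hz w hw hw0).symm
  funext z
  rw [← ext_coe f z]
  by_cases hz0 : (z : ℂ) = 0
  · rw [hz0, h0]; rfl
  · exact hz z (by simpa using z.norm_lt_one) hz0

/-- The Hardy space as a linear subspace of the space of functions on the disc. -/
def hpSubmodule (p : ℝ) [hp : Fact (1 ≤ p)] : Submodule ℂ (𝔻 → ℂ) where
  carrier := {f | MemHp p f}
  add_mem' hf hg := hf.add hp.out hg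
  zero_mem' := MemHp.zero hp.out
  smul_mem' c _ hf := hf.smul c

/-- The Hardy space `H^p(𝔻)`, `1 ≤ p < ∞`, with the norm `hpNorm p`. (It is a type of its own so
that it does not inherit the topology of pointwise convergence.) -/
def Hp (p : ℝ) [Fact (1 ≤ p)] : Type := hpSubmodule p

variable {p : ℝ} [hp : Fact (1 ≤ p)]

instance : AddCommGroup (Hp p) := inferInstanceAs (AddCommGroup (hpSubmodule p))

instance : Module ℂ (Hp p) := inferInstanceAs (Module ℂ (hpSubmodule p))

instance : CoeFun (Hp p) fun _ => 𝔻 → ℂ := ⟨fun f => f.1⟩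

instance : Norm (Hp p) := ⟨fun f => hpNorm p f⟩

theorem hp_core : NormedSpace.Core ℂ (Hp p) where
  norm_nonneg f := hpNorm_nonneg p f.1
  norm_smul c f := hpNorm_smul hp.out c f.1
  norm_triangle f g := hpNorm_add_le hp.out f.2 g.2
  norm_eq_zero_iff f := by
    refine ⟨fun h => Subtype.ext (eq_zero_of_hpNorm hp.out f.2 h), ?_⟩
    rintro rfl
    have h := hpNorm_smul hp.out 0 (0 : 𝔻 → ℂ)
    rw [zero_smul, norm_zero, zero_mul] at h
    exact h

instance : NormedAddCommGroup (Hp p) := NormedAddCommGroup.ofCore hp_core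

instance : NormedSpace ℂ (Hp p) := NormedSpace.ofCore hp_core

/-- `x₁, x₂, …` is a `δ`-pseudo-orbit of `T` (the value `x 0` plays no role). -/
def IsPseudoOrbit {X : Type*} [NormedAddCommGroup X] [NormedSpace ℂ X] (T : X →L[ℂ] X) (δ : ℝ)
    (x : ℕ → X) : Prop :=
  ∀ n : ℕ, 1 ≤ n → ‖T (x n) - x (n + 1)‖ ≤ δ

/-- The positive shadowing property of a bounded operator. -/
def PositiveShadowing {X : Type*} [NormedAddCommGroup X] [NormedSpace ℂ X]
    (T : X →L[ℂ] X) : Prop :=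
  ∀ ε : ℝ, 0 < ε → ∃ δ : ℝ, 0 < δ ∧ ∀ x : ℕ → X, IsPseudoOrbit T δ x →
    ∃ y : X, ∀ n : ℕ, 1 ≤ n → ‖(T ^ n) y - x n‖ ≤ ε

/-- `φ` is a parabolic linear fractional self-map of the disc: it is the restriction of a
linear fractional transformation `z ↦ (a z + b) / (c z + d)`, `a d - b c ≠ 0`, of the Riemann
sphere `ℂ ∪ {∞}` which has exactly one fixed point on the sphere. -/
def IsParabolic (φ : 𝔻 → 𝔻) : Prop :=
  ∃ g : GL (Fin 2) ℂ, (∀ z : 𝔻, ((φ z : ℂ) : OnePoint ℂ) = g • ((z : ℂ) : OnePoint ℂ)) ∧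
    ∃! w : OnePoint ℂ, g • w = w

end HardyShadowing

end

namespace HardyShadowing

open Metric Real

/-! Constants are fixed by every composition operator, so `n ↦ -nδ` is a pseudo-orbit of constant
functions. A function `y` shadowing it within `1` keeps `y ∘ φ^[n] + nδ` in the unit ball for all `n
≥ 1`. Through `z ↦ (z - α)⁻¹`, with `α` the fixed point, `φ` becomes the translation by some `s ≠
0`, whence `φ^[n] 0 = α + (ns + u)⁻¹`. So `y` is near `-nδ` where `z - α` is near `1 / (ns)`: it
behaves like `-(δ / s) / (z - α)`, a simple pole at the boundary, too singular even for `H¹`.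

To make this rigorous, pass to a primitive `H` of `y`. It is bounded on the disc, because any two
points of a circle are joined by an arc of that circle, along which the integral of `‖y‖` is
controlled (`norm_primitive_sub_le`). On the other hand `H ∘ φ^[n] + nδ φ^[n]` has derivative `(y ∘
φ^[n] + nδ) (φ^[n])'`, which is `O(1 / n²)` on compact sets. Comparing its values at `0` and `φ 0`
gives `H (φ^[n+1] 0) - H (φ^[n] 0) = δ / (sn) + O(1 / n²)`, and the harmonic series contradicts
boundedness (`not_bounded_of_increment`).

Boundedness of the operator is Littlewood subordination (`circleAverage_comp_le`), with a non-sharp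
constant: `‖F‖ ^ p` lies below its Poisson integral, a harmonic function that remains harmonic after
composition with a holomorphic map. -/

/-! ### Poisson integrals, growth estimates and subordination -/

theorem norm_circleAverage_le {f : ℂ → ℂ} {c : ℂ} {R : ℝ} :
    ‖circleAverage f c R‖ ≤ circleAverage (fun z => ‖f z‖) c R := by
  rw [circleAverage_def, circleAverage_def, norm_smul, norm_of_nonneg (by positivity)]
  exact mul_le_mul_of_nonneg_left
    (intervalIntegral.norm_integral_le_integral_norm two_pi_pos.le) (by positivity)

theorem poissonKernel_nonneg_of_mem {w ζ : ℂ} {R : ℝ} (hw : w ∈ ball (0 : ℂ) R)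
    (hζ : ζ ∈ sphere (0 : ℂ) R) : 0 ≤ poissonKernel 0 w ζ := by
  have h1 : ‖w‖ < R := by simpa using hw
  have h2 : ‖ζ‖ = R := by simpa using hζ
  rw [poissonKernel_def]
  simp only [sub_zero, h2]
  have := norm_nonneg w
  exact div_nonneg (by nlinarith) (by positivity)

theorem poissonKernel_le {w ζ : ℂ} {R : ℝ} (hw : w ∈ ball (0 : ℂ) R)
    (hζ : ζ ∈ sphere (0 : ℂ) R) : poissonKernel 0 w ζ ≤ (R + ‖w‖) / (R - ‖w‖) := by
  rw [poissonKernel_eq_re_herglotzRieszKernel]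
  simpa [herglotzRieszKernel_def] using re_herglotzRieszKernel_le hζ hw

theorem continuousOn_poissonKernel {w : ℂ} {R : ℝ} (hw : w ∈ ball (0 : ℂ) R) :
    ContinuousOn (poissonKernel 0 w) (sphere 0 |R|) := by
  rw [poissonKernel_eq_re_herglotzRieszKernel]
  exact Complex.continuous_re.comp_continuousOn (continuousOn_herglotzRieszKernel_sphere hw)

/-- The tangent line of `t ↦ t ^ p` at `s` lies below the graph. -/
theorem rpow_add_mul_sub_le_rpow {p s t : ℝ} (hp : 1 ≤ p) (hs : 0 ≤ s) (ht : 0 ≤ t) :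
    s ^ p + p * s ^ (p - 1) * (t - s) ≤ t ^ p := by
  -- The convention `0 ^ 0 = 1` makes `s = 0`, `p = 1` a case of its own. For `s > 0` this is
  -- Bernoulli's inequality at `t / s - 1`, scaled by `s ^ p`.
  rcases hs.eq_or_lt with rfl | hs
  · rcases hp.eq_or_lt with rfl | hp
    · simp
    · rw [zero_rpow (by linarith), zero_rpow (by linarith)]
      simpa using rpow_nonneg ht p
  · have h := one_add_mul_self_le_rpow_one_add (s := t / s - 1) (p := p)
      (by have : 0 ≤ t / s := by positivity
          linarith) hp
    have h2 := mul_le_mul_of_nonneg_left h (rpow_nonneg hs.le p)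
    rw [add_sub_cancel, ← mul_rpow hs.le (by positivity), mul_div_cancel₀ _ hs.ne'] at h2
    have h3 : s ^ p = s ^ (p - 1) * s := by
      rw [← rpow_add_one hs.ne', sub_add_cancel]
    refine le_trans (le_of_eq ?_) h2
    rw [h3]
    field_simp

/-- Subharmonicity of `‖F‖ ^ p`, `1 ≤ p`, in the form of a Poisson integral. -/
theorem norm_rpow_le_circleAverage_poissonKernel {p : ℝ} (hp : 1 ≤ p) {F : ℂ → ℂ} {R : ℝ} {w : ℂ}
    (hF : DiffContOnCl ℂ F (ball 0 R)) (hw : w ∈ ball (0 : ℂ) R) :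
    ‖F w‖ ^ p ≤ circleAverage (fun ζ => poissonKernel 0 w ζ * ‖F ζ‖ ^ p) 0 R := by
  have hR : 0 < R := pos_of_mem_ball hw
  have hPc := continuousOn_poissonKernel hw
  have hFc : ContinuousOn F (sphere 0 |R|) := by
    rw [abs_of_pos hR]
    exact hF.continuousOn_ball.mono sphere_subset_closedBall
  have hNc : ContinuousOn (fun ζ => ‖F ζ‖ ^ p) (sphere 0 |R|) :=
    hFc.norm.rpow_const fun _ _ => Or.inr (by linarith)
  -- The kernel has total mass `1`, since it reproduces the constant function `1`.
  have hone : circleAverage (poissonKernel 0 w) 0 R = 1 := by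
    have h := DiffContOnCl.circleAverage_poissonKernel_smul
      (f := fun _ : ℂ => (1 : ℂ)) (diffContOnCl_const) hw
    have h2 := Complex.ofRealCLM.circleAverage_comp_comm (f := poissonKernel 0 w)
      hPc.circleIntegrable'
    have h3 : (poissonKernel 0 w • fun _ : ℂ => (1 : ℂ)) = Complex.ofRealCLM ∘ poissonKernel 0 w := by
      funext z; simp
    rw [h3, h2] at h
    simpa using h
  set s := circleAverage (fun ζ => poissonKernel 0 w ζ * ‖F ζ‖) 0 R with hs
  have hle : ‖F w‖ ≤ s := by
    rw [← hF.circleAverage_poissonKernel_smul hw]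
    refine norm_circleAverage_le.trans_eq (circleAverage_congr_sphere fun ζ hζ => ?_)
    rw [abs_of_pos hR] at hζ
    simp [abs_of_nonneg (poissonKernel_nonneg_of_mem hw hζ)]
  have hs0 : 0 ≤ s := (norm_nonneg _).trans hle
  -- Jensen's inequality by hand: integrate the tangent line of `t ↦ t ^ p` at the Poisson mean `s`
  -- of `‖F‖`. The linear term averages to zero and leaves `s ^ p`.
  have h1 : circleAverage (fun ζ => (s ^ p - p * s ^ (p - 1) * s) • poissonKernel 0 w ζ +
      (p * s ^ (p - 1)) • (poissonKernel 0 w ζ * ‖F ζ‖)) 0 R = s ^ p := by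
    rw [circleAverage_fun_add (hPc.fun_const_smul _).circleIntegrable'
      ((hPc.fun_mul hFc.norm).fun_const_smul _).circleIntegrable', circleAverage_fun_smul,
      circleAverage_fun_smul, hone, ← hs]
    simp
  refine (rpow_le_rpow (norm_nonneg _) hle (by linarith)).trans ?_
  rw [← h1]
  refine circleAverage_mono ?_ ?_ ?_
  · exact ((hPc.fun_const_smul _).fun_add ((hPc.fun_mul hFc.norm).fun_const_smul _)).circleIntegrable'
  · exact (hPc.mul hNc).circleIntegrable'
  · intro ζ hζ
    rw [abs_of_pos hR] at hζ
    have := mul_le_mul_of_nonneg_left (rpow_add_mul_sub_le_rpow hp hs0 (norm_nonneg (F ζ)))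
      (poissonKernel_nonneg_of_mem hw hζ)
    refine le_trans (le_of_eq ?_) this
    simp only [smul_eq_mul]
    ring

theorem circleAverage_poissonKernel_mul_le {u : ℂ → ℝ} {R : ℝ} {w : ℂ}
    (hu : ContinuousOn u (sphere 0 |R|)) (hu0 : ∀ z, 0 ≤ u z) (hw : w ∈ ball (0 : ℂ) R) :
    circleAverage (fun ζ => poissonKernel 0 w ζ * u ζ) 0 R ≤
      (R + ‖w‖) / (R - ‖w‖) * circleAverage u 0 R := by
  rw [← smul_eq_mul, ← circleAverage_fun_smul]
  refine circleAverage_mono ((continuousOn_poissonKernel hw).mul hu).circleIntegrable'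
    (hu.fun_const_smul _).circleIntegrable' fun ζ hζ => ?_
  rw [abs_of_pos (pos_of_mem_ball hw)] at hζ
  exact mul_le_mul_of_nonneg_right (poissonKernel_le hw hζ) (hu0 ζ)

/-- Makes the Harnack constant independent of the radius. For `0 ≤ t` the worst case is `t = ρ`, `R
= (1 + ρ) / 2`, where the quotient is `(1 + 3ρ) / (1 - ρ)`. -/
theorem add_div_sub_le {t ρ R : ℝ} (ht : t ≤ ρ) (hρ : ρ < 1) (hR : (1 + ρ) / 2 ≤ R)
    (hR1 : R < 1) : (R + t) / (R - t) ≤ 4 / (1 - ρ) := by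
  rw [div_le_div_iff₀ (by linarith) (by linarith)]
  nlinarith

theorem differentiableOn_diffContOnCl {F : ℂ → ℂ} (hF : DifferentiableOn ℂ F (ball 0 1)) {R : ℝ}
    (hR1 : R < 1) : DiffContOnCl ℂ F (ball 0 R) :=
  (hF.mono ((closure_ball_subset_closedBall).trans (closedBall_subset_ball hR1))).diffContOnCl

theorem continuousOn_norm_rpow {p : ℝ} (hp : 1 ≤ p) {F : ℂ → ℂ}
    (hF : DifferentiableOn ℂ F (ball 0 1)) {R : ℝ} (hR0 : 0 < R) (hR1 : R < 1) :
    ContinuousOn (fun z => ‖F z‖ ^ p) (sphere 0 |R|) := by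
  rw [abs_of_pos hR0]
  exact ((hF.continuousOn.mono (sphere_subset_ball hR1)).norm.rpow_const
    fun _ _ => Or.inr (by linarith))

/-- Growth of a function with bounded integral means. -/
theorem norm_rpow_le_of_circleAverage_le {p : ℝ} (hp : 1 ≤ p) {F : ℂ → ℂ}
    (hF : DifferentiableOn ℂ F (ball 0 1)) {M : ℝ}
    (hM : ∀ R ∈ Set.Ioo (0 : ℝ) 1, circleAverage (fun z => ‖F z‖ ^ p) 0 R ≤ M)
    {ρ : ℝ} (hρ : ρ < 1) {w : ℂ} (hw : ‖w‖ ≤ ρ) : ‖F w‖ ^ p ≤ 4 / (1 - ρ) * M := by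
  have hw0 := norm_nonneg w
  set R := (1 + ρ) / 2 with hR
  have hR0 : 0 < R := by linarith
  have hR1 : R < 1 := by linarith
  have hwR : w ∈ ball (0 : ℂ) R := by rw [mem_ball_zero_iff]; linarith
  refine (norm_rpow_le_circleAverage_poissonKernel hp
    (differentiableOn_diffContOnCl hF hR1) hwR).trans
    ((circleAverage_poissonKernel_mul_le (continuousOn_norm_rpow hp hF hR0 hR1)
      (fun z => by positivity) hwR).trans ?_)
  refine mul_le_mul (add_div_sub_le hw hρ hR.ge hR1) (hM R ⟨hR0, hR1⟩)
    (circleAverage_nonneg_of_nonneg fun z _ => by positivity) ?_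
  have : 0 < 1 - ρ := by linarith
  positivity

/-- **Littlewood's subordination principle**, for exponents `1 ≤ p`. -/
theorem circleAverage_comp_le {p : ℝ} (hp : 1 ≤ p) {F ψ : ℂ → ℂ}
    (hF : DifferentiableOn ℂ F (ball 0 1)) (hψ : DifferentiableOn ℂ ψ (ball 0 1))
    (hmap : Set.MapsTo ψ (ball 0 1) (ball 0 1)) {M : ℝ}
    (hM : ∀ R ∈ Set.Ioo (0 : ℝ) 1, circleAverage (fun z => ‖F z‖ ^ p) 0 R ≤ M)
    {r : ℝ} (hr : r ∈ Set.Ioo (0 : ℝ) 1) :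
    circleAverage (fun z => ‖F (ψ z)‖ ^ p) 0 r ≤ 4 / (1 - ‖ψ 0‖) * M := by
  have hsub : closedBall (0 : ℂ) r ⊆ ball 0 1 := closedBall_subset_ball hr.2
  have hψ0 : ‖ψ 0‖ < 1 := by simpa using hmap (mem_ball_self one_pos)
  obtain ⟨z₀, hz₀, hmax⟩ := (isCompact_closedBall (0 : ℂ) r).exists_isMaxOn
    (nonempty_closedBall.2 hr.1.le) (hψ.continuousOn.mono hsub).norm
  have hz₀1 : ‖ψ z₀‖ < 1 := by simpa using hmap (hsub hz₀)
  -- The first entry keeps the Harnack constant at `ψ 0` under control; the second makes `ψ` map the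
  -- closed disc of radius `r` into the disc of radius `R`.
  set R := max ((1 + ‖ψ 0‖) / 2) ((1 + ‖ψ z₀‖) / 2) with hR
  have hRa : (1 + ‖ψ 0‖) / 2 ≤ R := le_max_left _ _
  have hRb : (1 + ‖ψ z₀‖) / 2 ≤ R := le_max_right _ _
  have hR1 : R < 1 := max_lt (by linarith) (by linarith)
  have hR0 : 0 < R := by have := norm_nonneg (ψ 0); linarith
  have hmapR : Set.MapsTo ψ (closedBall 0 r) (ball 0 R) := by
    intro z hz
    have h1 : ‖ψ z‖ ≤ ‖ψ z₀‖ := hmax hz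
    rw [mem_ball_zero_iff]
    linarith
  have hu := continuousOn_norm_rpow hp hF hR0 hR1
  have huI := hu.circleIntegrable'
  have huI' : CircleIntegrable (fun ζ => ((‖F ζ‖ ^ p : ℝ) : ℂ)) 0 R :=
    (Complex.continuous_ofReal.comp_continuousOn hu).circleIntegrable'
  -- `V` is holomorphic and its real part is the Poisson integral of `‖F‖ ^ p`. Hence `re (V ∘ ψ)`
  -- dominates `‖F ∘ ψ‖ ^ p` and has the mean value property.
  set V : ℂ → ℂ := fun w => circleAverage
    (fun ζ => herglotzRieszKernel 0 w ζ • ((‖F ζ‖ ^ p : ℝ) : ℂ)) 0 R with hV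
  have hVd : DifferentiableOn ℂ V (ball 0 R) :=
    differentiableOn_circleAverage_herglotzRieszKernel_smul huI'
  have hVre : ∀ w ∈ ball (0 : ℂ) R, (V w).re =
      circleAverage (fun ζ => poissonKernel 0 w ζ * ‖F ζ‖ ^ p) 0 R := by
    intro w hw
    rw [hV, re_circleAverage_herglotzRieszKernel_smul huI hw,
      ← poissonKernel_eq_re_herglotzRieszKernel]
    rfl
  have hVψ : DifferentiableOn ℂ (V ∘ ψ) (closedBall 0 r) :=
    hVd.comp (hψ.mono hsub) hmapR
  have hsph : sphere (0 : ℂ) |r| ⊆ closedBall 0 r := by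
    rw [abs_of_pos hr.1]; exact sphere_subset_closedBall
  have hVψI : CircleIntegrable (V ∘ ψ) 0 r := (hVψ.continuousOn.mono hsph).circleIntegrable'
  have hmean : circleAverage (Complex.reCLM ∘ (V ∘ ψ)) 0 r = (V (ψ 0)).re := by
    rw [Complex.reCLM.circleAverage_comp_comm hVψI]
    have hd : DiffContOnCl ℂ (V ∘ ψ) (ball 0 |r|) := by
      rw [abs_of_pos hr.1]
      exact (hVψ.mono closure_ball_subset_closedBall).diffContOnCl
    rw [hd.circleAverage]
    rfl
  have hFψ : ContinuousOn (fun z => ‖F (ψ z)‖ ^ p) (sphere 0 |r|) :=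
    ((hF.continuousOn.comp hψ.continuousOn hmap).mono (hsph.trans hsub)).norm.rpow_const
      fun _ _ => Or.inr (by linarith)
  have h0R : ψ 0 ∈ ball (0 : ℂ) R := hmapR (mem_closedBall_self hr.1.le)
  calc circleAverage (fun z => ‖F (ψ z)‖ ^ p) 0 r
      ≤ circleAverage (Complex.reCLM ∘ (V ∘ ψ)) 0 r := by
        refine circleAverage_mono hFψ.circleIntegrable'
          (Complex.reCLM.continuous.comp_continuousOn
            (hVψ.continuousOn.mono hsph)).circleIntegrable' fun z hz => ?_
        have hz' := hmapR (hsph hz)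
        exact (norm_rpow_le_circleAverage_poissonKernel hp
          (differentiableOn_diffContOnCl hF hR1) hz').trans_eq (hVre _ hz').symm
    _ = circleAverage (fun ζ => poissonKernel 0 (ψ 0) ζ * ‖F ζ‖ ^ p) 0 R := by
        rw [hmean, hVre _ h0R]
    _ ≤ (R + ‖ψ 0‖) / (R - ‖ψ 0‖) * circleAverage (fun z => ‖F z‖ ^ p) 0 R :=
        circleAverage_poissonKernel_mul_le hu (fun z => by positivity) h0R
    _ ≤ 4 / (1 - ‖ψ 0‖) * M := by
        refine mul_le_mul (add_div_sub_le le_rfl hψ0 hRa hR1) (hM R ⟨hR0, hR1⟩)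
          (circleAverage_nonneg_of_nonneg fun z _ => by positivity) ?_
        have : 0 < 1 - ‖ψ 0‖ := by linarith
        positivity

/-! ### Boundedness of primitives -/

/-- A primitive of a function with bounded integral means is bounded. -/
theorem norm_primitive_sub_le {F H : ℂ → ℂ} (hF : DifferentiableOn ℂ F (ball 0 1))
    (hH : ∀ z ∈ ball (0 : ℂ) 1, HasDerivAt H (F z) z) {M : ℝ}
    (hM : ∀ R ∈ Set.Ioo (0 : ℝ) 1, circleAverage (fun z => ‖F z‖) 0 R ≤ M) {z : ℂ}
    (hz : z ∈ ball (0 : ℂ) 1) : ‖H z - H 0‖ ≤ 2 * π * M := by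
  have hM0 : 0 ≤ M := (circleAverage_nonneg_of_nonneg fun z _ => norm_nonneg _).trans
    (hM (1 / 2) ⟨by norm_num, by norm_num⟩)
  rcases eq_or_ne z 0 with rfl | hz0
  · simp only [sub_self, norm_zero]; positivity
  set r := ‖z‖ with hr
  have hr0 : 0 < r := norm_pos_iff.2 hz0
  have hr1 : r < 1 := by simpa using hz
  have hmem : ∀ θ, circleMap 0 r θ ∈ ball (0 : ℂ) 1 := fun θ => by
    simp [abs_of_pos hr0, hr1]
  obtain ⟨θ₀, hθ₀, hzθ⟩ : ∃ θ₀ ∈ Set.Ico 0 (2 * π), z = circleMap 0 r θ₀ := by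
    obtain ⟨y, hy, hyeq⟩ := (periodic_circleMap 0 r).exists_mem_Ico₀ two_pi_pos z.arg
    exact ⟨y, hy, by rw [← hyeq, circleMap_zero, hr, Complex.norm_mul_exp_arg_mul_I]⟩
  have hFc : Continuous fun θ => F (circleMap 0 r θ) :=
    hF.continuousOn.comp_continuous (continuous_circleMap 0 r) hmem
  have hderiv : ∀ θ, HasDerivAt (fun θ => H (circleMap 0 r θ))
      (F (circleMap 0 r θ) * (circleMap 0 r θ * Complex.I)) θ := fun θ =>
    (hH _ (hmem θ)).comp θ (hasDerivAt_circleMap 0 r θ)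
  have hgc : Continuous fun θ => F (circleMap 0 r θ) * (circleMap 0 r θ * Complex.I) :=
    hFc.mul ((continuous_circleMap 0 r).mul continuous_const)
  -- Both angles lie in `[0, 2π)`, so the arc between them is covered by one full turn, whatever its
  -- orientation.
  have harc : ∀ θ ∈ Set.Ico 0 (2 * π), ‖H z - H (circleMap 0 r θ)‖ ≤ 2 * π * M := by
    intro θ hθ
    have hint : ∫ t in θ..θ₀, F (circleMap 0 r t) * (circleMap 0 r t * Complex.I) =
        H z - H (circleMap 0 r θ) := by
      rw [intervalIntegral.integral_eq_sub_of_hasDerivAt (fun t _ => hderiv t)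
        (hgc.intervalIntegrable _ _), hzθ]
    rw [← hint]
    have hle : ∫ t in (0 : ℝ)..2 * π, ‖F (circleMap 0 r t)‖ ≤ 2 * π * M := by
      have h := hM r ⟨hr0, hr1⟩
      rw [circleAverage_def, smul_eq_mul, inv_mul_le_iff₀ two_pi_pos] at h
      exact h
    refine le_trans ?_ hle
    refine intervalIntegral.norm_integral_le_integral_norm_uIoc.trans ?_
    rw [intervalIntegral.integral_of_le two_pi_pos.le]
    refine le_trans (MeasureTheory.setIntegral_mono_set
      (t := Set.Ioc 0 (2 * π)) ?_ ?_ ?_) ?_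
    · exact hgc.norm.integrableOn_Ioc
    · exact Filter.Eventually.of_forall fun t => norm_nonneg _
    · refine Filter.Eventually.of_forall fun t ht => ?_
      rcases Set.mem_uIoc.1 ht with h | h
      · exact ⟨hθ.1.trans_lt h.1, h.2.trans hθ₀.2.le⟩
      · exact ⟨hθ₀.1.trans_lt h.1, h.2.trans hθ.2.le⟩
    · refine MeasureTheory.setIntegral_mono hgc.norm.integrableOn_Ioc hFc.norm.integrableOn_Ioc
        fun t => ?_
      simp only [norm_mul, norm_circleMap_zero, abs_of_pos hr0, Complex.norm_I, mul_one]
      exact mul_le_of_le_one_right (norm_nonneg _) hr1.le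
  have hsph : ∀ ζ ∈ sphere (0 : ℂ) |r|, ‖H z - H ζ‖ ≤ 2 * π * M := by
    intro ζ hζ
    have hζ' : ‖ζ‖ = r := by simpa [abs_of_pos hr0] using hζ
    obtain ⟨y, hy, hyeq⟩ := (periodic_circleMap 0 r).exists_mem_Ico₀ two_pi_pos ζ.arg
    have : ζ = circleMap 0 r y := by
      rw [← hyeq, circleMap_zero, ← hζ', Complex.norm_mul_exp_arg_mul_I]
    rw [this]
    exact harc y hy
  have hHd : DifferentiableOn ℂ H (ball 0 1) := fun z hz =>
    (hH z hz).differentiableAt.differentiableWithinAt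
  have hHcl : DiffContOnCl ℂ H (ball 0 |r|) := by
    rw [abs_of_pos hr0]; exact differentiableOn_diffContOnCl hHd hr1
  have hHc : ContinuousOn H (sphere 0 |r|) := by
    rw [abs_of_pos hr0]; exact hHd.continuousOn.mono (sphere_subset_ball hr1)
  -- The centre is reached by averaging over the endpoint `ζ` rather than by a radial path, on which
  -- the means give no direct control.
  have havg : circleAverage (fun ζ => H z - H ζ) 0 r = H z - H 0 := by
    rw [circleAverage_fun_sub (circleIntegrable_const _ _ _) hHc.circleIntegrable',
      circleAverage_const, hHcl.circleAverage]
  rw [← havg]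
  exact norm_circleAverage_le.trans (circleAverage_mono_on_of_le_circle
    (continuousOn_const.sub hHc).norm.circleIntegrable' hsph)

/-! ### Parabolic self-maps as conjugates of translations -/

theorem mem_ball_coe (z : 𝔻) : (z : ℂ) ∈ ball (0 : ℂ) 1 := by
  simpa using z.norm_lt_one

theorem exists_coe_eq {z : ℂ} (hz : z ∈ ball (0 : ℂ) 1) : ∃ w : 𝔻, (w : ℂ) = z :=
  ⟨Complex.UnitDisc.mk z (by simpa using hz), rfl⟩

theorem coe_iterate_of_coe_eq_add {φ : 𝔻 → 𝔻} {t : ℂ} (h : ∀ z : 𝔻, (φ z : ℂ) = z + t) (n : ℕ)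
    (z : 𝔻) : ((φ^[n] z : 𝔻) : ℂ) = z + n * t := by
  induction n with
  | zero => simp
  | succ n ih =>
    rw [Function.iterate_succ_apply', h, ih]
    push_cast
    ring

/-- The disc is not invariant under a nontrivial translation. -/
theorem eq_zero_of_coe_eq_add {φ : 𝔻 → 𝔻} {t : ℂ} (h : ∀ z : 𝔻, (φ z : ℂ) = z + t) : t = 0 := by
  by_contra ht
  obtain ⟨n, hn⟩ := exists_nat_gt (1 / ‖t‖)
  have h1 := (φ^[n] 0).norm_lt_one
  rw [coe_iterate_of_coe_eq_add h] at h1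
  simp only [Complex.UnitDisc.coe_zero, zero_add, norm_mul, Complex.norm_natCast] at h1
  rw [div_lt_iff₀ (norm_pos_iff.2 ht)] at hn
  linarith

/-- `φ` is conjugate, through `z ↦ (z - α)⁻¹`, to the translation by `s`. -/
def IsConjTranslation (φ : 𝔻 → 𝔻) (α s : ℂ) : Prop :=
  ∀ z : 𝔻, (z : ℂ) ≠ α → (φ z : ℂ) ≠ α ∧ ((φ z : ℂ) - α)⁻¹ = s + ((z : ℂ) - α)⁻¹

theorem IsConjTranslation.iterate {φ : 𝔻 → 𝔻} {α s : ℂ} (h : IsConjTranslation φ α s) (n : ℕ) :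
    IsConjTranslation (φ^[n]) α (n * s) := by
  induction n with
  | zero => intro z hz; simpa using hz
  | succ n ih =>
    intro z hz
    obtain ⟨h1, h2⟩ := ih z hz
    obtain ⟨h3, h4⟩ := h _ h1
    rw [Function.iterate_succ_apply']
    refine ⟨h3, ?_⟩
    rw [h4, h2]
    push_cast
    ring

/-- If `α` were in the disc, so would be `α - (ns)⁻¹` for large `n`. The conjugating coordinate of
that point is `-ns`, so the `n`-th iterate would send it to coordinate `0`, the image of `∞`, which
no point of the disc attains. -/
theorem IsConjTranslation.one_le_norm {φ : 𝔻 → 𝔻} {α s : ℂ} (h : IsConjTranslation φ α s)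
    (hs : s ≠ 0) : 1 ≤ ‖α‖ := by
  by_contra! hα
  obtain ⟨n, hn⟩ := exists_nat_gt (1 / (‖s‖ * (1 - ‖α‖)))
  have hs' := norm_pos_iff.2 hs
  have hd : 0 < ‖s‖ * (1 - ‖α‖) := mul_pos hs' (by linarith)
  have hn0 : (0 : ℝ) < n := lt_trans (by positivity) hn
  have hns : (n * s : ℂ) ≠ 0 := mul_ne_zero (by exact_mod_cast hn0.ne') hs
  have hsmall : ‖(n * s : ℂ)⁻¹‖ < 1 - ‖α‖ := by
    rw [norm_inv, norm_mul, Complex.norm_natCast, inv_lt_comm₀ (by positivity) (by linarith)]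
    rw [div_lt_iff₀ hd] at hn
    rw [inv_lt_iff_one_lt_mul₀ (by linarith)]
    linarith
  obtain ⟨z, hz⟩ := exists_coe_eq (z := α - (n * s : ℂ)⁻¹) (by
    rw [mem_ball_zero_iff]
    have := norm_sub_le α (n * s : ℂ)⁻¹
    linarith)
  obtain ⟨h1, h2⟩ := h.iterate n z (by
    rw [hz]
    exact fun h => inv_ne_zero hns (sub_eq_self.1 h))
  rw [hz, sub_sub_cancel_left, inv_neg, inv_inv, add_neg_cancel, inv_eq_zero, sub_eq_zero] at h2
  exact h1 h2

/-- If `∞` is the fixed point, the map is affine without finite fixed point, hence a nontrivial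
translation, which cannot preserve the disc. If it is a finite `α`, uniqueness makes `α` a double
root of the fixed-point quadratic, which determines `a` and `b` from `c`, `d`, `α`. -/
theorem IsParabolic.exists_isConjTranslation {φ : 𝔻 → 𝔻} (hφ : IsParabolic φ) :
    ∃ α s : ℂ, s ≠ 0 ∧ 1 ≤ ‖α‖ ∧ IsConjTranslation φ α s := by
  obtain ⟨g, hg, w, hw, huniq⟩ := hφ
  have hdet : g 0 0 * g 1 1 - g 0 1 * g 1 0 ≠ 0 := by
    have := g.det_ne_zero
    rwa [Matrix.det_fin_two] at this
  have hval : ∀ z : 𝔻, g 1 0 * z + g 1 1 ≠ 0 ∧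
      (φ z : ℂ) = (g 0 0 * z + g 0 1) / (g 1 0 * z + g 1 1) := by
    intro z
    have h := hg z
    rw [OnePoint.smul_some_eq_ite] at h
    split_ifs at h with h0
    · exact absurd h (OnePoint.coe_ne_infty _)
    · exact ⟨h0, OnePoint.coe_injective h⟩
  have hfix : ∀ β : ℂ, g 1 0 * β + g 1 1 ≠ 0 →
      g 0 0 * β + g 0 1 = β * (g 1 0 * β + g 1 1) → g • (β : OnePoint ℂ) = β := by
    intro β h0 h1
    rw [OnePoint.smul_some_eq_ite, if_neg h0, h1, mul_div_cancel_right₀ _ h0]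
  set a := g 0 0
  set b := g 0 1
  set c := g 1 0
  set d := g 1 1
  induction w with
  | infty =>
    exfalso
    have hc : c = 0 := OnePoint.smul_infty_eq_self_iff.1 hw
    simp only [hc, zero_mul, zero_add, mul_zero, sub_zero] at hval hfix hdet
    have hd : d ≠ 0 := right_ne_zero_of_mul hdet
    have hnofix : ∀ β : ℂ, a * β + b ≠ β * d := fun β hβ =>
      OnePoint.coe_ne_infty β (huniq _ (hfix β hd hβ))
    have had : a = d := by
      by_contra had
      refine hnofix (b / (d - a)) ?_
      have : d - a ≠ 0 := sub_ne_zero.2 (Ne.symm had)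
      field_simp
      ring
    have ht : b / d = 0 := eq_zero_of_coe_eq_add (φ := φ) fun z => by
      rw [(hval z).2, had]
      field_simp
    have hb : b = 0 := by simpa [hd] using ht
    exact hnofix 0 (by simp [hb])
  | coe α =>
    have hc : c ≠ 0 := fun hc =>
      OnePoint.infty_ne_coe α (huniq _ (OnePoint.smul_infty_eq_self_iff.2 hc))
    rw [OnePoint.smul_some_eq_ite] at hw
    split_ifs at hw with he
    · exact absurd hw (OnePoint.infty_ne_coe α)
    have hw' := OnePoint.coe_injective hw
    change ¬ (c * α + d = 0) at he
    change (a * α + b) / (c * α + d) = α at hw'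
    rw [div_eq_iff he] at hw'
    -- By Vieta, `(a - d) / c - α` is the second root of the fixed-point equation. It is not the
    -- pole of `g`, for otherwise the determinant would vanish.
    have hβ0 : c * ((a - d) / c - α) + d ≠ 0 := by
      intro h
      apply hdet
      have h1 : a = c * α := by
        rw [mul_sub, mul_div_cancel₀ _ hc] at h
        linear_combination h
      rw [h1] at hw' ⊢
      linear_combination (-c) * hw'
    have hβ : (a - d) / c - α = α := by
      refine OnePoint.coe_injective (huniq _ (hfix _ hβ0 ?_))
      field_simp
      linear_combination c * hw'
    have ha : a = d + 2 * c * α := by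
      field_simp at hβ
      linear_combination hβ
    have hb : b = - c * α ^ 2 := by rw [ha] at hw'; linear_combination hw'
    have hs : c / (c * α + d) ≠ 0 := div_ne_zero hc he
    have hconj : IsConjTranslation φ α (c / (c * α + d)) := by
      intro z hz
      obtain ⟨h0, h1⟩ := hval z
      have hz' : (z : ℂ) - α ≠ 0 := sub_ne_zero.2 hz
      have key : (φ z : ℂ) - α = (c * α + d) * (z - α) / (c * z + d) := by
        rw [h1, ha, hb]
        field_simp
        ring
      refine ⟨?_, ?_⟩
      · rw [← sub_ne_zero, key]
        exact div_ne_zero (mul_ne_zero he hz') h0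
      · rw [key]
        field_simp
        ring
    exact ⟨α, _, hs, hconj.one_le_norm hs, hconj⟩

theorem IsConjTranslation.coe_iterate {φ : 𝔻 → 𝔻} {α s : ℂ} (h : IsConjTranslation φ α s)
    (hα : 1 ≤ ‖α‖) (n : ℕ) (z : 𝔻) :
    n * s + ((z : ℂ) - α)⁻¹ ≠ 0 ∧ ((φ^[n] z : 𝔻) : ℂ) = α + (n * s + ((z : ℂ) - α)⁻¹)⁻¹ := by
  obtain ⟨h1, h2⟩ := h.iterate n z (fun hz => by
    have := z.norm_lt_one
    rw [hz] at this
    linarith)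
  rw [← h2, inv_inv]
  exact ⟨inv_ne_zero (sub_ne_zero.2 h1), by ring⟩

theorem sub_ne_zero_of_mem_ball {z α : ℂ} (hα : 1 ≤ ‖α‖) (hz : z ∈ ball (0 : ℂ) 1) :
    z - α ≠ 0 := by
  rintro h
  rw [sub_eq_zero.1 h, mem_ball_zero_iff] at hz
  linarith

theorem IsConjTranslation.ne_zero {φ : 𝔻 → 𝔻} {α s : ℂ} (h : IsConjTranslation φ α s)
    (hα : 1 ≤ ‖α‖) (n : ℕ) {z : ℂ} (hz : z ∈ ball (0 : ℂ) 1) : n * s + (z - α)⁻¹ ≠ 0 := by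
  obtain ⟨w, rfl⟩ := exists_coe_eq hz
  exact (h.coe_iterate hα n w).1

theorem IsConjTranslation.hasDerivAt {φ : 𝔻 → 𝔻} {α s : ℂ} (h : IsConjTranslation φ α s)
    (hα : 1 ≤ ‖α‖) (n : ℕ) {z : ℂ} (hz : z ∈ ball (0 : ℂ) 1) :
    HasDerivAt (fun z => α + (n * s + (z - α)⁻¹)⁻¹)
      (((z - α) ^ 2)⁻¹ * ((n * s + (z - α)⁻¹) ^ 2)⁻¹) z := by
  have h1 := ((((hasDerivAt_id z).sub_const α).fun_inv
    (sub_ne_zero_of_mem_ball hα hz)).const_add (n * s)).fun_inv (h.ne_zero hα n hz)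
  refine (h1.const_add α).congr_deriv ?_
  simp only [id_eq]
  ring

theorem IsConjTranslation.isHol {φ : 𝔻 → 𝔻} {α s : ℂ} (h : IsConjTranslation φ α s)
    (hα : 1 ≤ ‖α‖) : IsHol fun z => (φ z : ℂ) := by
  have hd : DifferentiableOn ℂ (fun z => α + ((1 : ℕ) * s + (z - α)⁻¹)⁻¹) (ball 0 1) :=
    fun z hz => (h.hasDerivAt hα 1 hz).differentiableAt.differentiableWithinAt
  refine hd.congr fun z hz => ?_
  obtain ⟨w, rfl⟩ := exists_coe_eq hz
  rw [ext_coe]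
  exact (h.coe_iterate hα 1 w).2

/-! ### Composition operators on the Hardy space -/

theorem ext_comp {φ : 𝔻 → 𝔻} (f : 𝔻 → ℂ) {z : ℂ} (hz : z ∈ ball (0 : ℂ) 1) :
    ext (fun w => f (φ w)) z = ext f (ext (fun w => (φ w : ℂ)) z) := by
  obtain ⟨w, rfl⟩ := exists_coe_eq hz
  rw [ext_coe, ext_coe, ext_coe]

theorem mapsTo_ext (φ : 𝔻 → 𝔻) :
    Set.MapsTo (ext fun w => (φ w : ℂ)) (ball 0 1) (ball 0 1) := by
  intro z hz
  obtain ⟨w, rfl⟩ := exists_coe_eq hz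
  rw [ext_coe]
  exact mem_ball_coe _

theorem MemHp.mean_le_rpow {p : ℝ} (hp : 1 ≤ p) {f : 𝔻 → ℂ} (hf : MemHp p f) {r : ℝ}
    (hr : r ∈ Set.Ioo (0 : ℝ) 1) : mean p f r ≤ hpNorm p f ^ p :=
  mean_le_of_rpow_le hp (hf.mean_le hp hr)

theorem hpNorm_le_of_mean_le {p : ℝ} (hp : 1 ≤ p) {f : 𝔻 → ℂ} {C : ℝ}
    (hC : 0 ≤ C) (h : ∀ r ∈ Set.Ioo (0 : ℝ) 1, mean p f r ≤ C ^ p) : hpNorm p f ≤ C := by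
  have : Nonempty (Set.Ioo (0 : ℝ) 1) := ⟨⟨1 / 2, by norm_num, by norm_num⟩⟩
  have h2 := rpow_le_rpow (iSup_nonneg fun _ => mean_nonneg _ _ _)
    (ciSup_le fun r : Set.Ioo (0 : ℝ) 1 => h r r.2) (by positivity : 0 ≤ 1 / p)
  rwa [← rpow_mul hC, mul_one_div_cancel (by linarith), rpow_one] at h2

theorem mean_comp_le {p : ℝ} (hp : 1 ≤ p) {φ : 𝔻 → 𝔻} (hφ : IsHol fun z => (φ z : ℂ))
    {f : 𝔻 → ℂ} (hf : MemHp p f) {r : ℝ} (hr : r ∈ Set.Ioo (0 : ℝ) 1) :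
    mean p (fun z => f (φ z)) r ≤ 4 / (1 - ‖(φ 0 : ℂ)‖) * hpNorm p f ^ p := by
  have h := circleAverage_comp_le hp hf.1 hφ (mapsTo_ext φ)
    (fun R hR => hf.mean_le_rpow hp hR) hr
  have h0 : ext (fun w => (φ w : ℂ)) 0 = φ 0 := by
    rw [← Complex.UnitDisc.coe_zero, ext_coe]
  rw [h0] at h
  refine le_of_eq_of_le (circleAverage_congr_sphere fun z hz => ?_) h
  rw [abs_of_pos hr.1] at hz
  rw [ext_comp f (sphere_subset_ball hr.2 hz)]

theorem MemHp.comp {p : ℝ} (hp : 1 ≤ p) {φ : 𝔻 → 𝔻} (hφ : IsHol fun z => (φ z : ℂ))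
    {f : 𝔻 → ℂ} (hf : MemHp p f) : MemHp p fun z => f (φ z) := by
  refine ⟨?_, 4 / (1 - ‖(φ 0 : ℂ)‖) * hpNorm p f ^ p, ?_⟩
  · exact (hf.1.comp hφ (mapsTo_ext φ)).congr fun z hz => ext_comp f hz
  · rintro _ ⟨r, rfl⟩
    exact mean_comp_le hp hφ hf r.2

theorem hpNorm_comp_le {p : ℝ} (hp : 1 ≤ p) {φ : 𝔻 → 𝔻} (hφ : IsHol fun z => (φ z : ℂ))
    {f : 𝔻 → ℂ} (hf : MemHp p f) :
    hpNorm p (fun z => f (φ z)) ≤ (4 / (1 - ‖(φ 0 : ℂ)‖)) ^ (1 / p) * hpNorm p f := by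
  have h0 : 0 < 1 - ‖(φ 0 : ℂ)‖ := by linarith [(φ 0).norm_lt_one]
  have hn := hpNorm_nonneg p f
  refine hpNorm_le_of_mean_le hp (by positivity) fun r hr => ?_
  rw [mul_rpow (by positivity) hn, ← rpow_mul (by positivity), one_div_mul_cancel (by linarith),
    rpow_one]
  exact mean_comp_le hp hφ hf hr

/-- The composition operator with a holomorphic symbol on the Hardy space. -/
noncomputable def compHp (p : ℝ) [hp : Fact (1 ≤ p)] {φ : 𝔻 → 𝔻}
    (hφ : IsHol fun z => (φ z : ℂ)) : Hp p →L[ℂ] Hp p :=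
  LinearMap.mkContinuous
    { toFun := fun f => ⟨fun z => f.1 (φ z), f.2.comp hp.out hφ⟩
      map_add' := fun _ _ => rfl
      map_smul' := fun _ _ => rfl }
    ((4 / (1 - ‖(φ 0 : ℂ)‖)) ^ (1 / p)) fun f => hpNorm_comp_le hp.out hφ f.2

theorem compHp_apply {p : ℝ} [Fact (1 ≤ p)] {φ : 𝔻 → 𝔻} (hφ : IsHol fun z => (φ z : ℂ))
    (f : Hp p) (z : 𝔻) : compHp p hφ f z = f (φ z) := rfl

theorem compHp_pow_apply {p : ℝ} [Fact (1 ≤ p)] {φ : 𝔻 → 𝔻} (hφ : IsHol fun z => (φ z : ℂ))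
    (n : ℕ) (f : Hp p) (z : 𝔻) : (compHp p hφ ^ n) f z = f (φ^[n] z) := by
  induction n generalizing f with
  | zero => rfl
  | succ n ih =>
    rw [pow_succ, mul_apply_eq_comp, ih, compHp_apply,
      Function.iterate_succ_apply']

/-! ### Harmonic divergence and orbit asymptotics -/

/-- A sequence whose increments are `c / n + O(1 / n ^ 2)` with `c ≠ 0` is unbounded. -/
theorem not_bounded_of_increment {h : ℕ → ℂ} {c : ℂ} (hc : c ≠ 0) {B C : ℝ} {N : ℕ}
    (hB : ∀ n, ‖h n‖ ≤ B)
    (hC : ∀ n, N ≤ n → ‖h (n + 1) - h n - c / n‖ ≤ C / (n : ℝ) ^ 2) : False := by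
  have hsq : Summable fun m : ℕ => C / ((m + N : ℕ) : ℝ) ^ 2 :=
    (summable_nat_add_iff (f := fun m : ℕ => C / (m : ℝ) ^ 2) N).2
      (by simpa [div_eq_mul_inv] using
        (Real.summable_nat_pow_inv.2 (by norm_num : 1 < 2)).mul_left C)
  have hC0 : ∀ m : ℕ, 0 ≤ C / ((m + N : ℕ) : ℝ) ^ 2 := fun m =>
    (norm_nonneg _).trans (hC (m + N) (Nat.le_add_left _ _))
  have hc' := norm_pos_iff.2 hc
  -- Telescoping bounds `‖c‖` times each partial harmonic sum by `2B` plus the total error, which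
  -- would make the harmonic series converge.
  have hsum : Summable fun m : ℕ => 1 / ((m + N : ℕ) : ℝ) := by
    refine summable_of_sum_range_le (c := (B + B + ∑' m : ℕ, C / ((m + N : ℕ) : ℝ) ^ 2) / ‖c‖)
      (fun m => by positivity) fun k => ?_
    rw [le_div_iff₀ hc']
    have hid : c * ((∑ m ∈ Finset.range k, 1 / ((m + N : ℕ) : ℝ) : ℝ) : ℂ) =
        (h (k + N) - h N) - ∑ m ∈ Finset.range k,
          (h (m + N + 1) - h (m + N) - c / ((m + N : ℕ) : ℂ)) := by
      have htel : ∑ m ∈ Finset.range k, (h (m + N + 1) - h (m + N)) = h (k + N) - h N := by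
        have := Finset.sum_range_sub (fun m => h (m + N)) k
        simpa [add_right_comm] using this
      rw [Finset.sum_sub_distrib, htel, sub_sub_cancel, Complex.ofReal_sum, Finset.mul_sum]
      refine Finset.sum_congr rfl fun m _ => ?_
      push_cast
      ring
    have hnn : 0 ≤ ∑ m ∈ Finset.range k, 1 / ((m + N : ℕ) : ℝ) :=
      Finset.sum_nonneg fun m _ => by positivity
    have hnorm := congrArg norm hid
    rw [norm_mul, Complex.norm_real, norm_of_nonneg hnn] at hnorm
    rw [mul_comm, hnorm]
    refine (norm_sub_le _ _).trans (add_le_add ((norm_sub_le _ _).trans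
      (add_le_add (hB _) (hB _))) ?_)
    refine (norm_sum_le_of_le _ fun m _ => hC (m + N) (Nat.le_add_left _ _)).trans ?_
    exact hsq.sum_le_tsum _ fun m _ => hC0 m
  exact Real.not_summable_one_div_natCast
    ((summable_nat_add_iff (f := fun m : ℕ => 1 / (m : ℝ)) N).1 hsum)

theorem le_norm_mul_add {s u : ℂ} {L : ℝ} (hu : ‖u‖ ≤ L) {n : ℕ} (hn : 2 * L ≤ n * ‖s‖) :
    n * ‖s‖ / 2 ≤ ‖n * s + u‖ := by
  have h := norm_sub_norm_le (n * s : ℂ) (-u)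
  rw [norm_neg, sub_neg_eq_add, norm_mul, Complex.norm_natCast] at h
  linarith

/-- Asymptotics of the increments of the orbit `n ↦ (n s + u)⁻¹`. -/
theorem norm_orbit_increment_le {s u : ℂ} (hs : s ≠ 0) {n : ℕ} (hn0 : 1 ≤ n)
    (hn : 2 * ‖u‖ ≤ n * ‖s‖) :
    ‖n * (((n + 1 : ℕ) * s + u)⁻¹ - (n * s + u)⁻¹) + (s * n)⁻¹‖ ≤
      4 * (‖s * (s + 2 * u)‖ + ‖u * (s + u)‖) / ‖s‖ ^ 3 / (n : ℝ) ^ 2 := by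
  have hs' := norm_pos_iff.2 hs
  have hnpos : (1 : ℝ) ≤ n := by exact_mod_cast hn0
  have hn1 : 2 * ‖u‖ ≤ (n + 1 : ℕ) * ‖s‖ := by push_cast; nlinarith
  have hU := le_norm_mul_add le_rfl hn
  have hU' := le_norm_mul_add le_rfl hn1
  have hU'' : n * ‖s‖ / 2 ≤ ‖(n + 1 : ℕ) * s + u‖ := by
    refine le_trans ?_ hU'
    push_cast
    nlinarith
  have hpos : 0 < n * ‖s‖ / 2 := by positivity
  have hUne : n * s + u ≠ 0 := norm_pos_iff.1 (hpos.trans_le hU)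
  have hUne' : (n + 1 : ℕ) * s + u ≠ 0 := norm_pos_iff.1 (hpos.trans_le hU'')
  have hnC : (n : ℂ) ≠ 0 := by exact_mod_cast (by omega : n ≠ 0)
  -- The `n²` terms of the numerator cancel, leaving order `n` over order `n³`.
  have hid : n * (((n + 1 : ℕ) * s + u)⁻¹ - (n * s + u)⁻¹) + (s * n)⁻¹ =
      (n * (s * (s + 2 * u)) + u * (s + u)) /
        (s * n * ((n * s + u) * ((n + 1 : ℕ) * s + u))) := by
    field_simp
    push_cast
    ring
  rw [hid, norm_div, norm_mul, norm_mul, norm_mul, Complex.norm_natCast, div_div]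
  set D := ‖s * (s + 2 * u)‖ + ‖u * (s + u)‖ with hD
  have hnum : ‖n * (s * (s + 2 * u)) + u * (s + u)‖ ≤ n * D := by
    refine (norm_add_le _ _).trans ?_
    rw [norm_mul, Complex.norm_natCast, hD, mul_add]
    have := norm_nonneg (u * (s + u))
    nlinarith
  have hden : ‖s‖ * n * (n * ‖s‖ / 2 * (n * ‖s‖ / 2)) ≤
      ‖s‖ * n * (‖n * s + u‖ * ‖(n + 1 : ℕ) * s + u‖) := by gcongr
  calc _ ≤ n * D / (‖s‖ * n * (n * ‖s‖ / 2 * (n * ‖s‖ / 2))) :=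
        div_le_div₀ (by positivity) hnum (by positivity) hden
    _ = 4 * D / (‖s‖ ^ 3 * (n : ℝ) ^ 2) := by
        field_simp
        ring

/-! ### The contradiction for a shadowing function -/

theorem le_one_add_rpow {p t : ℝ} (hp : 1 ≤ p) (ht : 0 ≤ t) : t ≤ 1 + t ^ p := by
  rcases le_total t 1 with h | h
  · have := rpow_nonneg ht p
    linarith
  · have := self_le_rpow_of_one_le h hp
    linarith

theorem circleAverage_norm_le_one_add_mean {p : ℝ} (hp : 1 ≤ p) {f : 𝔻 → ℂ} (hf : IsHol f)
    {r : ℝ} (hr : r ∈ Set.Ioo (0 : ℝ) 1) :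
    circleAverage (fun z => ‖ext f z‖) 0 r ≤ 1 + mean p f r := by
  have hc := continuousOn_norm_rpow hp hf hr.1 hr.2
  have hc1 : ContinuousOn (fun z => ‖ext f z‖) (sphere 0 |r|) := by
    rw [abs_of_pos hr.1]
    exact (hf.continuousOn.mono (sphere_subset_ball hr.2)).norm
  calc circleAverage (fun z => ‖ext f z‖) 0 r
      ≤ circleAverage (fun z => 1 + ‖ext f z‖ ^ p) 0 r :=
        circleAverage_mono hc1.circleIntegrable'
          (continuousOn_const.fun_add hc).circleIntegrable'
          fun z _ => le_one_add_rpow hp (norm_nonneg _)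
    _ = 1 + mean p f r := by
        rw [circleAverage_fun_add (circleIntegrable_const _ _ _) hc.circleIntegrable',
          circleAverage_const]
        rfl

/-- No function `y` of the Hardy space is such that `y ∘ φ^[n] + n δ` stays in the unit ball. -/
theorem IsConjTranslation.false_of_bounded {p : ℝ} (hp : 1 ≤ p) {φ : 𝔻 → 𝔻} {α s : ℂ}
    (h : IsConjTranslation φ α s) (hs : s ≠ 0) (hα : 1 ≤ ‖α‖) {y : 𝔻 → ℂ} (hy : MemHp p y)
    {δ : ℝ} (hδ : 0 < δ) (hmem : ∀ n : ℕ, 1 ≤ n → MemHp p fun z => y (φ^[n] z) + n * δ)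
    (hle : ∀ n : ℕ, 1 ≤ n → hpNorm p (fun z => y (φ^[n] z) + n * δ) ≤ 1) : False := by
  obtain ⟨H, hH⟩ := hy.1.isExactOn_ball
  -- The closed disc of radius `ρ` is a compact convex set containing both `0` and `φ 0`; all
  -- uniform estimates are made on it.
  set ρ := ‖(φ 0 : ℂ)‖ with hρ
  have hρ0 : 0 ≤ ρ := norm_nonneg _
  have hρ1 : ρ < 1 := (φ 0).norm_lt_one
  have hρ' : 0 < 1 - ρ := by linarith
  have hs' := norm_pos_iff.2 hs
  set L := (1 - ρ)⁻¹ with hL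
  have hL0 : 0 < L := inv_pos.2 hρ'
  -- Bounds `y ∘ φ^[n] + nδ` on that disc uniformly in `n`: the growth estimate bounds its `p`-th
  -- power by `4 / (1 - ρ)`, and `t ≤ 1 + t ^ p` removes the exponent.
  set K := 1 + 4 / (1 - ρ) with hK
  set ψ : ℕ → ℂ → ℂ := fun n z => α + (n * s + (z - α)⁻¹)⁻¹ with hψ
  have hψφ : ∀ n (z : 𝔻), ψ n z = φ^[n] z := fun n z => (h.coe_iterate hα n z).2.symm
  have hball : closedBall (0 : ℂ) ρ ⊆ ball 0 1 := closedBall_subset_ball hρ1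
  have hinv : ∀ z ∈ closedBall (0 : ℂ) ρ, ‖(z - α)⁻¹‖ ≤ L := by
    intro z hz
    rw [mem_closedBall_zero_iff] at hz
    rw [norm_inv, hL]
    refine inv_anti₀ hρ' ?_
    have := norm_sub_norm_le α z
    rw [norm_sub_rev] at this
    linarith
  have hg : ∀ n : ℕ, 1 ≤ n → ∀ z ∈ closedBall (0 : ℂ) ρ, ‖ext y (ψ n z) + n * δ‖ ≤ K := by
    intro n hn z hz
    have hmean : ∀ R ∈ Set.Ioo (0 : ℝ) 1,
        circleAverage (fun z => ‖ext (fun z => y (φ^[n] z) + n * δ) z‖ ^ p) 0 R ≤ 1 := by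
      intro R hR
      refine ((hmem n hn).mean_le_rpow hp hR).trans ?_
      exact rpow_le_one (hpNorm_nonneg _ _) (hle n hn) (by linarith)
    have h1 := norm_rpow_le_of_circleAverage_le hp (hmem n hn).1 hmean hρ1
      (mem_closedBall_zero_iff.1 hz)
    obtain ⟨w, rfl⟩ := exists_coe_eq (hball hz)
    rw [ext_coe] at h1
    rw [hψφ, ext_coe]
    refine (le_one_add_rpow hp (norm_nonneg _)).trans ?_
    rw [hK]
    linarith
  obtain ⟨N, hN⟩ := exists_nat_gt (2 * L / ‖s‖)
  rw [div_lt_iff₀ hs'] at hN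
  have hN0 : 1 ≤ N := by
    rcases Nat.eq_zero_or_pos N with h0 | h0
    · rw [h0] at hN
      simp only [Nat.cast_zero, zero_mul] at hN
      linarith
    · exact h0
  have hlarge : ∀ n, N ≤ n → 2 * L ≤ n * ‖s‖ := by
    intro n hn
    have : (N : ℝ) ≤ n := by exact_mod_cast hn
    nlinarith
  -- The factor `K` bounds `y ∘ ψ n + nδ`, the parenthesis divided by `n²` bounds the derivative of
  -- `ψ n`, and `ρ` is the distance from `0` to `φ 0`.
  set C₁ := K * (L ^ 2 * (4 / ‖s‖ ^ 2)) * ρ with hC₁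
  have hstep : ∀ n, N ≤ n → ‖(H (ψ n (φ 0)) + n * δ * ψ n (φ 0)) -
      (H (ψ n 0) + n * δ * ψ n 0)‖ ≤ C₁ / (n : ℝ) ^ 2 := by
    intro n hn
    have hn1 : 1 ≤ n := hN0.trans hn
    have hnpos : (0 : ℝ) < n := by exact_mod_cast hn1
    have hderiv : ∀ z ∈ closedBall (0 : ℂ) ρ,
        HasDerivWithinAt (fun z => H (ψ n z) + n * δ * ψ n z)
          ((ext y (ψ n z) + n * δ) * (((z - α) ^ 2)⁻¹ * ((n * s + (z - α)⁻¹) ^ 2)⁻¹))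
          (closedBall 0 ρ) z := by
      intro z hz
      have hd := h.hasDerivAt hα n (hball hz)
      have hψb : ψ n z ∈ ball (0 : ℂ) 1 := by
        obtain ⟨w, rfl⟩ := exists_coe_eq (hball hz)
        rw [hψφ]
        exact mem_ball_coe _
      have hd2 := ((hH _ hψb).comp z hd).add (hd.const_mul (n * δ : ℂ))
      refine (hd2.congr_deriv ?_).hasDerivWithinAt
      ring
    have hbound : ∀ z ∈ closedBall (0 : ℂ) ρ,
        ‖(ext y (ψ n z) + n * δ) * (((z - α) ^ 2)⁻¹ * ((n * s + (z - α)⁻¹) ^ 2)⁻¹)‖ ≤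
          K * (L ^ 2 * (4 / (n * ‖s‖) ^ 2)) := by
      intro z hz
      have hK0 : 0 ≤ K := by positivity
      have h1 := le_norm_mul_add (hinv z hz) (hlarge n hn)
      have h2 : (‖n * s + (z - α)⁻¹‖ ^ 2)⁻¹ ≤ 4 / (n * ‖s‖) ^ 2 := by
        refine (inv_anti₀ (by positivity) (pow_le_pow_left₀ (by positivity) h1 2)).trans_eq ?_
        field_simp
        norm_num
      have h3 : (‖z - α‖ ^ 2)⁻¹ ≤ L ^ 2 := by
        rw [← inv_pow, ← norm_inv]
        exact pow_le_pow_left₀ (norm_nonneg _) (hinv z hz) 2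
      rw [norm_mul, norm_mul, norm_inv, norm_inv, norm_pow, norm_pow]
      exact mul_le_mul (hg n hn1 z hz) (mul_le_mul h3 h2 (by positivity) (by positivity))
        (by positivity) hK0
    have hmv := (convex_closedBall (0 : ℂ) ρ).norm_image_sub_le_of_norm_hasDerivWithin_le
      hderiv hbound (mem_closedBall_self hρ0)
      (mem_closedBall_zero_iff.2 (le_refl ‖(φ 0 : ℂ)‖))
    refine hmv.trans_eq ?_
    rw [sub_zero, ← hρ, hC₁]
    field_simp
  set u := (0 - α)⁻¹ with hu
  have huL : ‖u‖ ≤ L := hinv 0 (mem_closedBall_self hρ0)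
  set C₂ := 4 * (‖s * (s + 2 * u)‖ + ‖u * (s + u)‖) / ‖s‖ ^ 3 with hC₂
  -- Turns the comparison of the points `φ 0` and `0` at level `n` into an increment along the orbit
  -- of `0`.
  have hnext : ∀ n, ψ n (φ 0) = ψ (n + 1) 0 := by
    intro n
    rw [hψφ, ← Complex.UnitDisc.coe_zero, hψφ, Function.iterate_succ_apply]
  set M := 1 + hpNorm p y ^ p with hM
  have hM1 : ∀ R ∈ Set.Ioo (0 : ℝ) 1, circleAverage (fun z => ‖ext y z‖) 0 R ≤ M := fun R hR =>
    (circleAverage_norm_le_one_add_mean hp hy.1 hR).trans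
      (add_le_add le_rfl (hy.mean_le_rpow hp hR))
  refine not_bounded_of_increment (h := fun n => H (ψ n 0) - H 0) (c := δ / s)
    (B := 2 * π * M) (C := C₁ + δ * C₂) (N := N)
    (div_ne_zero (by exact_mod_cast hδ.ne') hs) (fun n => ?_) fun n hn => ?_
  · refine norm_primitive_sub_le hy.1 hH hM1 ?_
    rw [← Complex.UnitDisc.coe_zero, hψφ]
    exact mem_ball_coe _
  · have h1 := hstep n hn
    have h2 := norm_orbit_increment_le (u := u) hs (hN0.trans hn)
      ((mul_le_mul_of_nonneg_left huL (by norm_num)).trans (hlarge n hn))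
    rw [hnext] at h1
    -- The main term `δ / (sn)` comes from `-nδ (ψ (n + 1) 0 - ψ n 0)`, since the orbit increments
    -- are `-1 / (s n²)` to leading order.
    have hid : H (ψ (n + 1) 0) - H 0 - (H (ψ n 0) - H 0) - (δ : ℂ) / s / n =
        ((H (ψ (n + 1) 0) + n * δ * ψ (n + 1) 0) - (H (ψ n 0) + n * δ * ψ n 0)) -
          δ * (n * (((n + 1 : ℕ) * s + u)⁻¹ - (n * s + u)⁻¹) + (s * n)⁻¹) := by
      simp only [hψ, ← hu]
      rw [div_div, div_eq_mul_inv]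
      ring
    rw [hid]
    refine (norm_sub_le _ _).trans ?_
    rw [norm_mul, Complex.norm_real, norm_of_nonneg hδ.le, add_div, mul_div_assoc δ]
    exact add_le_add h1 (mul_le_mul_of_nonneg_left h2 hδ.le)

/-! ### The pseudo-orbit of constants -/

theorem mean_one {p r : ℝ} (hr : r ∈ Set.Ioo (0 : ℝ) 1) : mean p 1 r = 1 := by
  refine circleAverage_const_on_circle fun z hz => ?_
  rw [abs_of_pos hr.1] at hz
  obtain ⟨w, rfl⟩ := exists_coe_eq (sphere_subset_ball hr.2 hz)
  simp [ext_coe]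

theorem MemHp.one (p : ℝ) : MemHp p 1 := by
  refine ⟨(differentiableOn_const (1 : ℂ)).congr fun z hz => ?_, 1, ?_⟩
  · obtain ⟨w, rfl⟩ := exists_coe_eq hz
    simp [ext_coe]
  · rintro _ ⟨r, rfl⟩
    exact (mean_one r.2).le

theorem hpNorm_one_le {p : ℝ} (hp : 1 ≤ p) : hpNorm p 1 ≤ 1 :=
  hpNorm_le_of_mean_le hp zero_le_one fun r hr => by rw [mean_one hr, one_rpow]

theorem IsConjTranslation.not_positiveShadowing {p : ℝ} [hp : Fact (1 ≤ p)] {φ : 𝔻 → 𝔻} {α s : ℂ}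
    (h : IsConjTranslation φ α s) (hs : s ≠ 0) (hα : 1 ≤ ‖α‖) :
    ¬ PositiveShadowing (compHp p (h.isHol hα)) := by
  intro hsh
  obtain ⟨δ, hδ, hpseudo⟩ := hsh 1 one_pos
  let e : Hp p := ⟨1, MemHp.one p⟩
  have he : ‖e‖ ≤ 1 := hpNorm_one_le hp.out
  have hTe : compHp p (h.isHol hα) e = e := rfl
  -- The operator fixes `e`, so each jump of this sequence is exactly `δ • e`.
  obtain ⟨y, hy⟩ := hpseudo (fun n => (-(n * δ) : ℂ) • e) fun n _ => by
    rw [map_smul, hTe, ← sub_smul, norm_smul]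
    have hcoef : (-(n * δ) - -((n + 1 : ℕ) * δ) : ℂ) = δ := by push_cast; ring
    rw [hcoef, Complex.norm_real, norm_of_nonneg hδ.le]
    exact mul_le_of_le_one_right hδ.le he
  have hval : ∀ n : ℕ, ((compHp p (h.isHol hα) ^ n) y - (-(n * δ) : ℂ) • e).1 =
      fun z => y.1 (φ^[n] z) + n * δ := by
    intro n
    funext z
    change ((compHp p (h.isHol hα) ^ n) y).1 z - (-(n * δ) : ℂ) * 1 = _
    rw [compHp_pow_apply]
    ring
  refine h.false_of_bounded hp.out hs hα y.2 hδ (fun n _ => ?_) fun n hn => ?_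
  · rw [← hval n]
    exact ((compHp p (h.isHol hα) ^ n) y - (-(n * δ) : ℂ) • e).2
  · rw [← hval n]
    exact hy n hn

end HardyShadowing

theorem mainTheorem11 (p : ℝ) [Fact (1 ≤ p)] (φ : Complex.UnitDisc → Complex.UnitDisc)
    (hφ : HardyShadowing.IsParabolic φ) :
    ∃ T : HardyShadowing.Hp p →L[ℂ] HardyShadowing.Hp p,
      (∀ (f : HardyShadowing.Hp p) (z : Complex.UnitDisc), T f z = f (φ z)) ∧
        ¬ HardyShadowing.PositiveShadowing T := by
  obtain ⟨α, s, hs, hα, h⟩ := hφ.exists_isConjTranslation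
  exact ⟨HardyShadowing.compHp p (h.isHol hα), HardyShadowing.compHp_apply (h.isHol hα),
    h.not_positiveShadowing hs hα⟩
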